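/- A lattice polytope in $\mathbb{R}^d$ is the convex hull of a nonempty finite subset of $\mathbb{Z}^d$; it is a $0/1$-polytope if it is the convex hull of a nonempty subset of $\{0,1\}^d$. Its Ehrhart polynomial is the polynomial $i_P$ with $i_P(n)=\#(nP\cap\mathbb{Z}^d)$ for all integers $n\ge 1$. For $d\ge 1$ let $P_d\subset\mathbb{R}^d$ be the order polytope $\{(x_0,\dots,x_{d-1}) : 0\le x_0\le x_k\le 1 \text{ for } 0\le k\le d-1\}$, and let $B_d$ be the $d$-th Bernoulli polynomial. **Theorem 1.3.** (i) For every real $t>0$ and every sufficiently large $d$ there is a $d$-dimensional lattice polytope in $\mathbb{R}^d$ whose Ehrhart polynomial has degree $d$ and a real root strictly larger than $t$. (ii) For every $d\ge 1$ there are a $d$-dimensional $0/1$-polytope in $\mathbb{R}^d$ and a real zero $\alpha_d$ of its Ehrhart polynomial such that $\lim_{d\to\infty}\alpha_d/d=1/(2\pi e)=0.0585\cdots$. Moreover, whenever $4\nmid d$ the polytope can be taken to be $P_d$. (iii) For every $d\ge1$, $P_d$ is a $d$-dimensional $0/1$-polytope, and for every $d\ge 2$ its Ehrhart polynomial is $$i_{P_d}(n)=\frac{B_d(n+2)-B_d(0)}{d}.$$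 -/

import Mathlib

open Filter Topology Polynomial
open scoped Pointwise

/-- The point of `ℝ^d` with the given integer coordinates. -/
def intPoint {d : ℕ} (z : Fin d → ℤ) : Fin d → ℝ := fun i => (z i : ℝ)

/-- A lattice polytope in `ℝ^d`: the convex hull of a finite nonempty set of points of `ℤ^d`. -/
def IsLatticePolytope {d : ℕ} (P : Set (Fin d → ℝ)) : Prop :=
  ∃ V : Finset (Fin d → ℤ), V.Nonempty ∧ P = convexHull ℝ (intPoint '' (V : Set (Fin d → ℤ)))

/-- A 0/1-polytope in `ℝ^d`: the convex hull of a nonempty set of points of `{0, 1}^d`. -/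
def IsZeroOnePolytope {d : ℕ} (P : Set (Fin d → ℝ)) : Prop :=
  ∃ V : Set (Fin d → ℝ), V.Nonempty ∧ (∀ v ∈ V, ∀ i, v i = 0 ∨ v i = 1) ∧ P = convexHull ℝ V

/-- The dimension of `P`, that is, of its affine hull. -/
noncomputable def polytopeDim {d : ℕ} (P : Set (Fin d → ℝ)) : ℕ :=
  Module.finrank ℝ (vectorSpan ℝ P)

/-- The number of points of `ℤ^d` in the dilate `n P`. -/
noncomputable def latticeCount {d : ℕ} (P : Set (Fin d → ℝ)) (n : ℕ) : ℕ :=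
  Set.ncard {z : Fin d → ℤ | intPoint z ∈ (n : ℝ) • P}

/-- `p` is the Ehrhart polynomial of `P`: its value at every positive integer `n` is the number of
lattice points of `n P`. There is at most one such `p`. -/
def IsEhrhartPolynomial {d : ℕ} (P : Set (Fin d → ℝ)) (p : ℝ[X]) : Prop :=
  ∀ n : ℕ, 1 ≤ n → p.eval (n : ℝ) = (latticeCount P n : ℝ)

/-- The order polytope `0 ≤ x₀ ≤ x_k ≤ 1` in `ℝ^d`, with coordinates `x₀, …, x_{d-1}`. -/
def orderPolytope (d : ℕ) : Set (Fin d → ℝ) :=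
  {x | ∀ i k : Fin d, i.val = 0 → 0 ≤ x i ∧ x i ≤ x k ∧ x k ≤ 1}

/-- The polynomial `(B_d(X + 2) - B_d(0)) / d`, where `B_d` is the Bernoulli polynomial. -/
noncomputable def bernoulliEhrhart (d : ℕ) : ℝ[X] :=
  let B : ℝ[X] := (Polynomial.bernoulli d).map (algebraMap ℚ ℝ)
  C ((d : ℝ)⁻¹) * (B.comp (X + C 2) - C (B.eval 0))

/-! Slicing the dilated order polytope by its first coordinate gives cubes, so the lattice count is
a sum of `(d-1)`-th powers, which the difference equation of `B_d` sums. Real zeros are thus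
solutions of `B_d(x + 2) = B_d(0)`.

If `4 ∤ d`, the Fourier series shows that `B_d` dips below `B_d(0)` on `[0, 1]` by at least `d! / (4
(2π)^d)` (`exists_realBernoulli_le`). Translating by `m` raises the value by at most `d (m + 1)^d`,
which by `d^d ≤ e^d d!` is eventually smaller when `m + 1 ≤ c d`, `c < 1/(2πe)`. As `B_d(m) ≥
B_d(0)`, a solution lies in `[m, m + 1]` (`exists_realBernoulli_eq`).

If `4 ∣ d`, then `B_d` is minimal on `[0, 1]` at `0` and there is no dip; the product of `P_{d-1}`
with an interval is used instead. -/

/-- The order polytope of the poset on `0, …, e` whose relations are `0 ≤ k + 1` for `k ∈ s`. -/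
def fanPolytope {e : ℕ} (s : Finset (Fin e)) : Set (Fin (e + 1) → ℝ) :=
  {x | (∀ k, 0 ≤ x k ∧ x k ≤ 1) ∧ ∀ k ∈ s, x 0 ≤ x k.succ}

theorem orderPolytope_succ (e : ℕ) :
    orderPolytope (e + 1) = fanPolytope (Finset.univ : Finset (Fin e)) := by
  ext x
  simp only [orderPolytope, fanPolytope, Set.mem_ofPred_eq, Finset.mem_univ, forall_const]
  constructor
  · intro h
    have h0 := fun k => h 0 k rfl
    exact ⟨fun k => ⟨(h0 k).1.trans (h0 k).2.1, (h0 k).2.2⟩, fun k => (h0 k.succ).2.1⟩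
  · rintro ⟨h1, h2⟩ i k hi
    obtain rfl : i = 0 := Fin.ext hi
    refine ⟨(h1 0).1, ?_, (h1 k).2⟩
    refine Fin.cases le_rfl h2 k

/-! ### Vertices, dimension and lattice points of the polytopes -/

theorem convex_fanPolytope {e : ℕ} (s : Finset (Fin e)) : Convex ℝ (fanPolytope s) := by
  rintro x ⟨hx, hx'⟩ y ⟨hy, hy'⟩ a b ha hb hab
  refine ⟨fun k => ⟨?_, ?_⟩, fun k hk => ?_⟩ <;> simp only [Pi.add_apply, Pi.smul_apply, smul_eq_mul]
  · exact add_nonneg (mul_nonneg ha (hx k).1) (mul_nonneg hb (hy k).1)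
  · nlinarith [mul_le_mul_of_nonneg_left (hx k).2 ha, mul_le_mul_of_nonneg_left (hy k).2 hb]
  · exact add_le_add (mul_le_mul_of_nonneg_left (hx' k hk) ha)
      (mul_le_mul_of_nonneg_left (hy' k hk) hb)

theorem convexHull_zero_one : convexHull ℝ ({0, 1} : Set ℝ) = Set.Icc 0 1 := by
  rw [convexHull_pair, segment_eq_Icc zero_le_one]

/-- The faces `x 0 = 0` and `x 0 = 1` are products of points and unit intervals, hence hulls of
their 0/1 points. Every `x` lies on a segment joining these faces, with weight `x 0` on the second.
-/
theorem isZeroOnePolytope_fanPolytope {e : ℕ} (s : Finset (Fin e)) :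
    IsZeroOnePolytope (fanPolytope s) := by
  have hconv : fanPolytope s =
      convexHull ℝ {v ∈ fanPolytope s | ∀ i, v i = 0 ∨ v i = 1} := by
    refine Set.Subset.antisymm (fun x hx => ?_)
      (convexHull_min (fun v hv => hv.1) (convex_fanPolytope s))
    let t₀ : Fin (e + 1) → Set ℝ := Fin.cons {0} fun _ => {0, 1}
    let t₁ : Fin (e + 1) → Set ℝ := Fin.cons {1} fun k => if k ∈ s then {1} else {0, 1}
    have h01 : ∀ v : Fin (e + 1) → ℝ, (∀ i, v i = 0 ∨ v i = 1) → ∀ k, 0 ≤ v k ∧ v k ≤ 1 := by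
      intro v hv k
      rcases hv k with h | h <;> simp [h]
    have ht₀ : Set.univ.pi t₀ ⊆ {v ∈ fanPolytope s | ∀ i, v i = 0 ∨ v i = 1} := by
      intro v hv
      have hv0 : v 0 = 0 := hv 0 trivial
      have hvs : ∀ k : Fin e, v k.succ = 0 ∨ v k.succ = 1 := fun k => hv k.succ trivial
      have hv' : ∀ i, v i = 0 ∨ v i = 1 := Fin.cases (Or.inl hv0) hvs
      exact ⟨⟨h01 v hv', fun k _ => hv0 ▸ (h01 v hv' k.succ).1⟩, hv'⟩
    have ht₁ : Set.univ.pi t₁ ⊆ {v ∈ fanPolytope s | ∀ i, v i = 0 ∨ v i = 1} := by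
      intro v hv
      have hv0 : v 0 = 1 := hv 0 trivial
      have hvs : ∀ k : Fin e, v k.succ ∈ if k ∈ s then ({1} : Set ℝ) else {0, 1} :=
        fun k => hv k.succ trivial
      have hv' : ∀ i, v i = 0 ∨ v i = 1 := by
        refine Fin.cases (Or.inr hv0) fun k => ?_
        have := hvs k
        split_ifs at this
        · exact Or.inr this
        · exact this
      refine ⟨⟨h01 v hv', fun k hk => ?_⟩, hv'⟩
      have := hvs k
      rw [if_pos hk, Set.mem_singleton_iff] at this
      rw [hv0, this]
    obtain ⟨hx1, hx2⟩ := hx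
    -- Solves `x = x 0 • u + (1 - x 0) • y`; if `x 0 = 1` the quotient is `0`, harmless since its
    -- weight vanishes.
    let y : Fin (e + 1) → ℝ :=
      Fin.cons 0 fun k => if k ∈ s then (x k.succ - x 0) / (1 - x 0) else x k.succ
    let u : Fin (e + 1) → ℝ := Fin.cons 1 fun k => if k ∈ s then 1 else x k.succ
    have hy : y ∈ convexHull ℝ {v ∈ fanPolytope s | ∀ i, v i = 0 ∨ v i = 1} := by
      refine convexHull_mono ht₀ (mem_convexHull_pi fun i _ => ?_)
      refine Fin.cases ?_ (fun k => ?_) i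
      · simp [y, t₀]
      · simp only [y, t₀, Fin.cons_succ, convexHull_zero_one]
        split_ifs with hk
        · have := hx2 k hk
          have := (hx1 k.succ).2
          exact ⟨div_nonneg (by linarith) (by linarith), div_le_one_of_le₀ (by linarith) (by linarith)⟩
        · exact hx1 _
    have hu : u ∈ convexHull ℝ {v ∈ fanPolytope s | ∀ i, v i = 0 ∨ v i = 1} := by
      refine convexHull_mono ht₁ (mem_convexHull_pi fun i _ => ?_)
      refine Fin.cases ?_ (fun k => ?_) i
      · simp [u, t₁]
      · simp only [u, t₁, Fin.cons_succ]
        split_ifs with hk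
        · simp
        · rw [convexHull_zero_one]; exact hx1 _
    have hxuy : x = x 0 • u + (1 - x 0) • y := by
      funext i
      refine Fin.cases ?_ (fun k => ?_) i
      · simp [u, y]
      · simp only [u, y, Pi.add_apply, Pi.smul_apply, smul_eq_mul, Fin.cons_succ]
        split_ifs with hk
        · by_cases h : 1 - x 0 = 0
          · have := hx2 k hk
            have := (hx1 k.succ).2
            rw [h]; linarith
          · field_simp; ring
        · ring
    rw [hxuy]
    exact convex_convexHull ℝ _ hu hy (hx1 0).1 (by linarith [(hx1 0).2]) (by ring)
  refine ⟨{v ∈ fanPolytope s | ∀ i, v i = 0 ∨ v i = 1}, ⟨0, ?_, ?_⟩, fun v hv => hv.2, hconv⟩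
  · simp [fanPolytope]
  · simp

theorem polytopeDim_fanPolytope {e : ℕ} (s : Finset (Fin e)) :
    polytopeDim (fanPolytope s) = e + 1 := by
  let t : Fin (e + 1) → Set ℝ := Fin.cons (Set.Ioo 0 (1 / 2)) fun _ => Set.Ioo (1 / 2) 1
  have ht : IsOpen (Set.univ.pi t) := by
    refine isOpen_set_pi Set.finite_univ fun i _ => ?_
    refine Fin.cases isOpen_Ioo (fun k => isOpen_Ioo) i
  have hne : (Set.univ.pi t).Nonempty := by
    refine ⟨Fin.cons (1 / 4) fun _ => 3 / 4, fun i _ => ?_⟩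
    refine Fin.cases ?_ (fun k => ?_) i
    · simp only [t, Fin.cons_zero]; norm_num
    · simp only [t, Fin.cons_succ]; norm_num
  have hsub : Set.univ.pi t ⊆ fanPolytope s := by
    intro x hx
    have h0 : x 0 ∈ Set.Ioo (0 : ℝ) (1 / 2) := hx 0 trivial
    have h1 : ∀ k : Fin e, x k.succ ∈ Set.Ioo (1 / 2 : ℝ) 1 := fun k => hx k.succ trivial
    refine ⟨Fin.cases ⟨h0.1.le, by linarith [h0.2]⟩ fun k => ⟨by linarith [(h1 k).1], (h1 k).2.le⟩,
      fun k _ => by linarith [(h1 k).1, h0.2]⟩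
  have htop : affineSpan ℝ (fanPolytope s) = ⊤ :=
    top_unique ((ht.affineSpan_eq_top hne).symm.le.trans (affineSpan_mono ℝ hsub))
  rw [polytopeDim, AffineSubspace.vectorSpan_eq_top_of_affineSpan_eq_top ℝ _ _ htop]
  simp

theorem intPoint_mem_smul_fanPolytope {e : ℕ} (s : Finset (Fin e)) {n : ℕ} (hn : 1 ≤ n)
    (z : Fin (e + 1) → ℤ) :
    intPoint z ∈ (n : ℝ) • fanPolytope s ↔
      (∀ k, 0 ≤ z k ∧ z k ≤ n) ∧ ∀ k ∈ s, z 0 ≤ z k.succ := by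
  have hn0 : (0 : ℝ) < n := by exact_mod_cast hn
  rw [Set.mem_smul_set_iff_inv_smul_mem₀ hn0.ne']
  simp only [fanPolytope, Set.mem_ofPred_eq, Pi.smul_apply, smul_eq_mul, intPoint]
  refine and_congr (forall_congr' fun k => and_congr ?_ ?_) (forall₂_congr fun k _ => ?_)
  · rw [mul_nonneg_iff_of_pos_left (inv_pos.2 hn0)]
    exact_mod_cast Iff.rfl
  · rw [inv_mul_le_iff₀ hn0, mul_one]
    exact_mod_cast Iff.rfl
  · rw [mul_le_mul_iff_right₀ (inv_pos.2 hn0)]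
    exact_mod_cast Iff.rfl

/-- In the slice `z 0 = j`, coordinates in `s` have `n + 1 - j` choices and the others `n + 1`. The
subtracted `0 ^ s.card` is the term `j = 0`, nonzero only for empty `s`. -/
theorem latticeCount_fanPolytope {e : ℕ} (s : Finset (Fin e)) {n : ℕ} (hn : 1 ≤ n) :
    latticeCount (fanPolytope s) n =
      (∑ j ∈ Finset.range (n + 2), j ^ s.card - 0 ^ s.card) * (n + 1) ^ (e - s.card) := by
  let t : ℕ → Fin (e + 1) → Finset ℤ := fun j =>
    Fin.cons {(j : ℤ)} fun k => if k ∈ s then Finset.Icc (j : ℤ) n else Finset.Icc 0 (n : ℤ)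
  have hset : {z : Fin (e + 1) → ℤ | intPoint z ∈ (n : ℝ) • fanPolytope s} =
      ((Finset.range (n + 1)).biUnion fun j => Fintype.piFinset (t j) : Finset _) := by
    ext z
    simp only [Set.mem_ofPred_eq, intPoint_mem_smul_fanPolytope s hn, Finset.coe_biUnion,
      Set.mem_iUnion, Finset.mem_coe, Finset.mem_range, Fintype.mem_piFinset, exists_prop]
    constructor
    · rintro ⟨h1, h2⟩
      refine ⟨(z 0).toNat, ?_, ?_⟩
      · have := h1 0
        omega
      · have h0 : ((z 0).toNat : ℤ) = z 0 := Int.toNat_of_nonneg (h1 0).1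
        refine Fin.cases ?_ fun k => ?_
        · simp [t, h0]
        · simp only [t, Fin.cons_succ, h0]
          split_ifs with hk
          · exact Finset.mem_Icc.2 ⟨h2 k hk, (h1 _).2⟩
          · exact Finset.mem_Icc.2 (h1 _)
    · rintro ⟨j, hj, h⟩
      have h0 : z 0 = j := by simpa [t] using h 0
      have hs : ∀ k : Fin e,
          z k.succ ∈ if k ∈ s then Finset.Icc (j : ℤ) n else Finset.Icc 0 (n : ℤ) :=
        fun k => h k.succ
      constructor
      · refine Fin.cases ⟨by omega, by omega⟩ fun k => ?_
        have := hs k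
        split_ifs at this <;> rw [Finset.mem_Icc] at this <;> omega
      · intro k hk
        have := hs k
        rw [if_pos hk, Finset.mem_Icc] at this
        omega
  have hcard : ∀ j ∈ Finset.range (n + 1), (Fintype.piFinset (t j)).card =
      (n + 1 - j) ^ s.card * (n + 1) ^ (e - s.card) := by
    intro j hj
    rw [Finset.mem_range] at hj
    rw [Fintype.card_piFinset, Fin.prod_univ_succ]
    have h1 : ∀ k : Fin e, (t j k.succ).card = if k ∈ s then n + 1 - j else n + 1 := by
      intro k
      simp only [t, Fin.cons_succ]
      split_ifs <;> simp only [Int.card_Icc] <;> omega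
    simp_rw [h1, Finset.prod_ite, Finset.prod_const]
    have h2 : Finset.univ.filter (fun k => k ∈ s) = s := by simp
    have h3 : Finset.univ.filter (fun k => k ∉ s) = sᶜ := by ext; simp
    rw [h2, h3, Finset.card_compl, Fintype.card_fin]
    simp [t]
  rw [latticeCount, hset, Set.ncard_coe_finset, Finset.card_biUnion, Finset.sum_congr rfl hcard,
    ← Finset.sum_mul, Finset.sum_range_succ' _ (n + 1), Nat.add_sub_cancel]
  · rw [← Finset.sum_range_reflect]
    congr 1
    refine Finset.sum_congr rfl fun j hj => ?_
    rw [Finset.mem_range] at hj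
    congr 1
    omega
  · intro i _ j _ hij
    rw [Function.onFun, Finset.disjoint_left]
    intro z hi hj
    have h1 : z 0 = i := by simpa [t] using Fintype.mem_piFinset.1 hi 0
    have h2 : z 0 = j := by simpa [t] using Fintype.mem_piFinset.1 hj 0
    exact hij (by exact_mod_cast h1.symm.trans h2)

theorem IsZeroOnePolytope.isLatticePolytope {d : ℕ} {P : Set (Fin d → ℝ)}
    (h : IsZeroOnePolytope P) : IsLatticePolytope P := by
  classical
  obtain ⟨V, ⟨v, hv⟩, h01, rfl⟩ := h
  have hfl : ∀ w ∈ V, intPoint (fun i => ⌊w i⌋) = w := by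
    intro w hw
    funext i
    rcases h01 w hw i with h | h <;> simp [intPoint, h]
  have hfin : V.Finite := by
    refine (Set.Finite.pi' (t := fun _ : Fin d => ({0, 1} : Set ℝ)) fun _ => by simp).subset ?_
    exact fun w hw i => h01 w hw i
  refine ⟨hfin.toFinset.image fun w i => ⌊w i⌋, ⟨_, Finset.mem_image_of_mem _ (hfin.mem_toFinset.2 hv)⟩, ?_⟩
  congr 1
  ext w
  simp only [Finset.coe_image, Set.Finite.coe_toFinset, Set.image_image, Set.mem_image]
  constructor
  · exact fun hw => ⟨w, hw, hfl w hw⟩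
  · rintro ⟨w', hw', rfl⟩
    rwa [hfl w' hw']

/-! ### Bernoulli polynomials as power sums -/

open scoped Nat

/-- The Bernoulli polynomial with real coefficients. -/
noncomputable abbrev realBernoulli (d : ℕ) : ℝ[X] := (Polynomial.bernoulli d).map (algebraMap ℚ ℝ)

theorem eval_realBernoulli_one_add (d : ℕ) (x : ℝ) :
    (realBernoulli d).eval (1 + x) = (realBernoulli d).eval x + d * x ^ (d - 1) := by
  have h := congrArg (fun p : ℚ[X] => (p.map (algebraMap ℚ ℝ)).eval x)
    (Polynomial.bernoulli_comp_one_add_X d)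
  simpa [Polynomial.map_comp] using h

theorem eval_realBernoulli_add_nat (d m : ℕ) (x : ℝ) :
    (realBernoulli d).eval (x + m) =
      (realBernoulli d).eval x + d * ∑ j ∈ Finset.range m, (x + j) ^ (d - 1) := by
  induction m with
  | zero => simp
  | succ m ih =>
    rw [Finset.sum_range_succ, mul_add, ← add_assoc, ← ih, ← eval_realBernoulli_one_add]
    push_cast
    ring_nf

theorem eval_bernoulliEhrhart (d : ℕ) (x : ℝ) :
    (bernoulliEhrhart d).eval x =
      (d : ℝ)⁻¹ * ((realBernoulli d).eval (x + 2) - (realBernoulli d).eval 0) := by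
  simp [bernoulliEhrhart]

/-- For `e = 0` the term `j = 0` is `0 ^ 0 = 1`, one too many for the lattice count; this is why
dimension 1 is treated apart. -/
theorem eval_bernoulliEhrhart_nat (e n : ℕ) :
    (bernoulliEhrhart (e + 1)).eval (n : ℝ) = ∑ j ∈ Finset.range (n + 2), (j : ℝ) ^ e := by
  have h := eval_realBernoulli_add_nat (e + 1) (n + 2) 0
  rw [eval_bernoulliEhrhart]
  push_cast at h ⊢
  simp only [zero_add] at h
  rw [h, add_sub_cancel_left, ← mul_assoc, inv_mul_cancel₀ (by positivity), one_mul]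

theorem isRoot_bernoulliEhrhart_iff {d : ℕ} (hd : d ≠ 0) (x : ℝ) :
    (bernoulliEhrhart d).IsRoot x ↔
      (realBernoulli d).eval (x + 2) = (realBernoulli d).eval 0 := by
  rw [IsRoot.def, eval_bernoulliEhrhart, mul_eq_zero, sub_eq_zero, or_iff_right]
  simpa using hd

theorem isRoot_bernoulliEhrhart_neg_one {d : ℕ} (hd : 2 ≤ d) :
    (bernoulliEhrhart d).IsRoot (-1) := by
  rw [isRoot_bernoulliEhrhart_iff (by omega)]
  have h := eval_realBernoulli_one_add d 0
  rw [zero_pow (by omega)] at h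
  norm_num at h ⊢
  exact h

theorem natDegree_realBernoulli (d : ℕ) : (realBernoulli d).natDegree = d := by
  rw [realBernoulli, natDegree_map]
  refine natDegree_eq_of_le_of_coeff_ne_zero ?_ ?_
  · rw [natDegree_le_iff_coeff_eq_zero]
    intro i hi
    rw [Polynomial.coeff_bernoulli, if_neg (by omega)]
  · simp [Polynomial.coeff_bernoulli]

theorem natDegree_bernoulliEhrhart {d : ℕ} (hd : d ≠ 0) : (bernoulliEhrhart d).natDegree = d := by
  have h : bernoulliEhrhart d = C ((d : ℝ)⁻¹) *
    ((realBernoulli d).comp (X + C 2) - C ((realBernoulli d).eval 0)) := rfl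
  rw [h, natDegree_C_mul (by simpa using hd), natDegree_sub_C, natDegree_comp,
    natDegree_X_add_C, mul_one, natDegree_realBernoulli]

/-! ### Oscillation on the unit interval, from Fourier series -/

/-- A lower bound for the oscillation of an even Bernoulli polynomial below its value at `0`. -/
theorem realBernoulli_eval_half_le {k : ℕ} (hk : Odd k) :
    (realBernoulli (2 * k)).eval (1 / 2) - (realBernoulli (2 * k)).eval 0 ≤
      -(1 / 4) * ((2 * k)! / (2 * Real.pi) ^ (2 * k)) := by
  have hk0 : k ≠ 0 := by rintro rfl; simp at hk
  have h1 := hasSum_one_div_nat_pow_mul_cos hk0 (x := 1 / 2) (by norm_num)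
  have h0 := hasSum_one_div_nat_pow_mul_cos hk0 (x := 0) (by norm_num)
  -- All terms of the difference are nonnegative, so the term `n = 1`, which is `2`, bounds it from
  -- below.
  have h := h0.sub h1
  have hle := le_hasSum h 1 (by
    intro n _
    rw [← mul_sub]
    refine mul_nonneg (by positivity) ?_
    simp only [mul_zero, Real.cos_zero]
    linarith [Real.cos_le_one (2 * Real.pi * n * (1 / 2))])
  have hcos : Real.cos (2 * Real.pi * (1 : ℕ) * (1 / 2)) = -1 := by
    rw [← Real.cos_pi]; congr 1; push_cast; ring
  have hsign : (-1 : ℝ) ^ (k + 1) = 1 := hk.add_one.neg_one_pow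
  rw [hcos, hsign, ← mul_sub, ← mul_sub] at hle
  simp only [Nat.cast_one, one_pow, mul_zero, Real.cos_zero] at hle
  have hA : (0 : ℝ) < (2 * Real.pi) ^ (2 * k) := by positivity
  have hF : (0 : ℝ) < (2 * k)! := by positivity
  have hle' := mul_le_mul_of_nonneg_right hle (div_pos hF hA).le
  have e : 1 * (2 * Real.pi) ^ (2 * k) / 2 / ((2 * k)! : ℝ) *
      ((realBernoulli (2 * k)).eval 0 - (realBernoulli (2 * k)).eval (1 / 2)) *
      ((2 * k)! / (2 * Real.pi) ^ (2 * k)) =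
      ((realBernoulli (2 * k)).eval 0 - (realBernoulli (2 * k)).eval (1 / 2)) / 2 := by
    field_simp
  rw [e] at hle'
  have := div_pos hF hA
  linarith

/-- The first term outweighs the rest: `S ≥ 1 - (π²/6 - 1) > 1/4`. -/
theorem one_fourth_le_of_hasSum_pow_mul {d : ℕ} (hd : 2 ≤ d) {g : ℕ → ℝ} (hg : ∀ n, -1 ≤ g n)
    (hg1 : g 1 = 1) {S : ℝ} (hS : HasSum (fun n : ℕ => 1 / (n : ℝ) ^ d * g n) S) :
    1 / 4 ≤ S := by
  have h := hS.add hasSum_zeta_two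
  have hle := le_hasSum h 1 (by
    intro n _
    rcases Nat.eq_zero_or_pos n with rfl | hn
    · simp [zero_pow (show d ≠ 0 by omega)]
    · have hn1 : (1 : ℝ) ≤ n := by exact_mod_cast hn
      have h1 : 1 / (n : ℝ) ^ d ≤ 1 / (n : ℝ) ^ 2 :=
        one_div_le_one_div_of_le (by positivity) (pow_le_pow_right₀ hn1 hd)
      have h2 : (0 : ℝ) < 1 / (n : ℝ) ^ d := by positivity
      nlinarith [hg n])
  rw [hg1] at hle
  have hpi := Real.pi_lt_d2
  have hpi0 := Real.pi_pos
  norm_num at hle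
  nlinarith

/-- Here `B_d(0) = 0`, and `y` is `1/4` or `3/4` according to the parity of `k`, so that the leading
sine term is `-1` after the sign of the series. -/
theorem exists_realBernoulli_odd_le {k : ℕ} (hk : k ≠ 0) :
    ∃ y ∈ Set.Icc (0 : ℝ) 1,
      (realBernoulli (2 * k + 1)).eval y - (realBernoulli (2 * k + 1)).eval 0 ≤
        -(1 / 4) * ((2 * k + 1)! / (2 * Real.pi) ^ (2 * k + 1)) := by
  have hzero : (realBernoulli (2 * k + 1)).eval 0 = 0 := by
    rw [realBernoulli, Polynomial.eval_zero_map, Polynomial.bernoulli_eval_zero,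
      bernoulli_eq_zero_of_odd (by simp) (by omega), map_zero]
  have hA : (0 : ℝ) < (2 * Real.pi) ^ (2 * k + 1) := by positivity
  have hF : (0 : ℝ) < (2 * k + 1)! := by positivity
  have hAF := div_pos hF hA
  have key : ∀ b : ℝ, 1 / 4 ≤ 1 * (2 * Real.pi) ^ (2 * k + 1) / 2 /
      ((2 * k + 1)! : ℝ) * b → (1 / 4) * ((2 * k + 1)! / (2 * Real.pi) ^ (2 * k + 1)) ≤ b := by
    intro b h
    have h' := mul_le_mul_of_nonneg_right h hAF.le
    have e : 1 * (2 * Real.pi) ^ (2 * k + 1) / 2 / ((2 * k + 1)! : ℝ) * b *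
        ((2 * k + 1)! / (2 * Real.pi) ^ (2 * k + 1)) = b / 2 := by
      field_simp
    rw [e] at h'
    linarith
  rw [hzero]
  rcases Nat.even_or_odd k with hpar | hpar
  · refine ⟨1 / 4, by norm_num, ?_⟩
    have hs := hasSum_one_div_nat_pow_mul_sin hk (x := 1 / 4) (by norm_num)
    have hb := one_fourth_le_of_hasSum_pow_mul (by omega) (fun n => Real.neg_one_le_sin _) (by
      rw [show 2 * Real.pi * (1 : ℕ) * (1 / 4) = Real.pi / 2 by push_cast; ring,
        Real.sin_pi_div_two]) hs
    have hsign : (-1 : ℝ) ^ (k + 1) = -1 := hpar.add_one.neg_one_pow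
    have := key (-(realBernoulli (2 * k + 1)).eval (1 / 4))
      (by rw [hsign] at hb; refine hb.trans_eq ?_; ring)
    linarith
  · refine ⟨3 / 4, by norm_num, ?_⟩
    have hs := (hasSum_one_div_nat_pow_mul_sin hk (x := 3 / 4) (by norm_num)).neg
    simp only [← mul_neg] at hs
    have hb := one_fourth_le_of_hasSum_pow_mul (by omega)
      (fun n => neg_le_neg (Real.sin_le_one _)) (by
      rw [← Real.sin_sub_pi, show 2 * Real.pi * (1 : ℕ) * (3 / 4) - Real.pi = Real.pi / 2 by
        push_cast; ring, Real.sin_pi_div_two]) hs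
    have hsign : (-1 : ℝ) ^ (k + 1) = 1 := hpar.add_one.neg_one_pow
    have := key (-(realBernoulli (2 * k + 1)).eval (3 / 4))
      (by rw [hsign] at hb; exact hb)
    linarith

theorem exists_realBernoulli_le {d : ℕ} (hd : 2 ≤ d) (h4 : ¬ 4 ∣ d) :
    ∃ y ∈ Set.Icc (0 : ℝ) 1, (realBernoulli d).eval y - (realBernoulli d).eval 0 ≤
      -(1 / 4) * (d ! / (2 * Real.pi) ^ d) := by
  rcases Nat.even_or_odd' d with ⟨k, rfl | rfl⟩
  · refine ⟨1 / 2, by norm_num, realBernoulli_eval_half_le ?_⟩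
    rw [← Nat.not_even_iff_odd, even_iff_two_dvd]
    omega
  · exact exists_realBernoulli_odd_le (by omega)

/-! ### Real zeros of linear growth -/

/-- If `(m + 1)^d` is small against the oscillation of `B_d`, then `B_d` takes the value `B_d(0)`
between `m` and `m + 1`. -/
theorem exists_realBernoulli_eq {d m : ℕ} (hd : 2 ≤ d) (h4 : ¬ 4 ∣ d)
    (hm : (d : ℝ) * (m + 1) ^ d ≤ 1 / 4 * (d ! / (2 * Real.pi) ^ d)) :
    ∃ x ∈ Set.Icc (m : ℝ) (m + 1), (realBernoulli d).eval x = (realBernoulli d).eval 0 := by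
  obtain ⟨y, ⟨hy0, hy1⟩, hy⟩ := exists_realBernoulli_le hd h4
  have hleft : (realBernoulli d).eval 0 ≤ (realBernoulli d).eval (m : ℝ) := by
    have h := eval_realBernoulli_add_nat d m 0
    rw [zero_add] at h
    rw [h, le_add_iff_nonneg_right]
    exact mul_nonneg (by positivity) (Finset.sum_nonneg fun j _ => by positivity)
  have hright : (realBernoulli d).eval (y + m) ≤ (realBernoulli d).eval 0 := by
    rw [eval_realBernoulli_add_nat]
    have hsum : ∑ j ∈ Finset.range m, (y + j) ^ (d - 1) ≤ ((m : ℝ) + 1) ^ d := by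
      calc ∑ j ∈ Finset.range m, (y + j) ^ (d - 1)
          ≤ ∑ j ∈ Finset.range m, ((m : ℝ) + 1) ^ (d - 1) := by
            refine Finset.sum_le_sum fun j hj => ?_
            have : (j : ℝ) ≤ m := by exact_mod_cast (Finset.mem_range.1 hj).le
            exact pow_le_pow_left₀ (by positivity) (by linarith) _
        _ = m * ((m : ℝ) + 1) ^ (d - 1) := by simp
        _ ≤ (m + 1) * ((m : ℝ) + 1) ^ (d - 1) := by gcongr; linarith
        _ = ((m : ℝ) + 1) ^ d := by rw [← pow_succ', Nat.sub_add_cancel (by omega)]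
    have := mul_le_mul_of_nonneg_left hsum (Nat.cast_nonneg (α := ℝ) d)
    linarith
  obtain ⟨x, hx, hxe⟩ := intermediate_value_Icc' (show (m : ℝ) ≤ y + m by linarith)
    (realBernoulli d).continuous.continuousOn ⟨hright, hleft⟩
  exact ⟨x, ⟨hx.1, hx.2.trans (by linarith)⟩, hxe⟩

/-- By `d^d ≤ e^d d!` this reduces to `d (2πec)^d → 0`, the source of the constant `1/(2πe)`. -/
theorem eventually_mul_pow_le_factorial {c : ℝ} (hc0 : 0 < c)
    (hc : c < 1 / (2 * Real.pi * Real.exp 1)) :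
    ∀ᶠ d : ℕ in atTop, (d : ℝ) * (c * d) ^ d ≤ 1 / 4 * (d ! / (2 * Real.pi) ^ d) := by
  have hq : 2 * Real.pi * Real.exp 1 * c < 1 := by
    rw [lt_div_iff₀ (by positivity)] at hc
    linarith
  have ht := tendsto_self_mul_const_pow_of_lt_one (by positivity) hq
  filter_upwards [ht.eventually_le_const (show (0 : ℝ) < 1 / 4 by norm_num)] with d hd
  have hfac : (d : ℝ) ^ d ≤ Real.exp 1 ^ d * d ! := by
    have := Real.pow_div_factorial_le_exp (d : ℝ) (Nat.cast_nonneg d) d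
    rwa [div_le_iff₀ (by positivity), ← mul_one (d : ℝ), Real.exp_nat_mul, mul_one] at this
  rw [← mul_div_assoc, le_div_iff₀ (by positivity)]
  calc (d : ℝ) * (c * d) ^ d * (2 * Real.pi) ^ d
      = d * (c ^ d * (2 * Real.pi) ^ d) * (d : ℝ) ^ d := by rw [mul_pow]; ring
    _ ≤ d * (c ^ d * (2 * Real.pi) ^ d) * (Real.exp 1 ^ d * d !) := by gcongr
    _ = d * (2 * Real.pi * Real.exp 1 * c) ^ d * d ! := by simp only [mul_pow]; ring
    _ ≤ 1 / 4 * d ! := by gcongr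

theorem eventually_exists_isRoot_bernoulliEhrhart {c : ℝ} (hc0 : 0 < c)
    (hc : c < 1 / (2 * Real.pi * Real.exp 1)) :
    ∀ᶠ d : ℕ in atTop, ¬ 4 ∣ d →
      ∃ x : ℝ, (bernoulliEhrhart d).IsRoot x ∧ c * d - 4 ≤ x ∧ x ≤ c * d := by
  filter_upwards [eventually_mul_pow_le_factorial hc0 hc, eventually_ge_atTop 2,
    (tendsto_natCast_atTop_atTop.const_mul_atTop hc0).eventually_ge_atTop (1 : ℝ)]
    with d hd hd2 hcd h4
  have hf1 : 1 ≤ ⌊c * d⌋₊ := Nat.one_le_floor_iff _ |>.2 hcd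
  obtain ⟨m, hm⟩ : ∃ m, ⌊c * d⌋₊ = m + 1 := ⟨_, (Nat.sub_add_cancel hf1).symm⟩
  have hle : (m : ℝ) + 1 ≤ c * d := by
    have := Nat.floor_le (show 0 ≤ c * d by positivity)
    rw [hm] at this
    exact_mod_cast this
  have hlt : c * d < (m : ℝ) + 1 + 1 := by
    have := Nat.lt_floor_add_one (c * (d : ℝ))
    rw [hm] at this
    exact_mod_cast this
  obtain ⟨x, hx, hxe⟩ := exists_realBernoulli_eq hd2 h4
    (le_trans (by gcongr) hd : (d : ℝ) * (m + 1) ^ d ≤ 1 / 4 * (d ! / (2 * Real.pi) ^ d))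
  -- Rounding `c d` down to `m + 1` costs at most 2 in `m`, and the argument shift costs 2 more.
  refine ⟨x - 2, (isRoot_bernoulliEhrhart_iff (by omega) _).2 (by rwa [sub_add_cancel]), ?_, ?_⟩
  · linarith [hx.1]
  · linarith [hx.2]

/-! ### The polytopes in each dimension and the choice of zeros -/

theorem isEhrhartPolynomial_orderPolytope {d : ℕ} (hd : 2 ≤ d) :
    IsEhrhartPolynomial (orderPolytope d) (bernoulliEhrhart d) := by
  obtain ⟨e, rfl⟩ : ∃ e, d = e + 1 := ⟨d - 1, by omega⟩
  intro n hn
  rw [orderPolytope_succ, latticeCount_fanPolytope _ hn, eval_bernoulliEhrhart_nat]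
  simp [zero_pow (show e ≠ 0 by omega)]

theorem isZeroOnePolytope_orderPolytope {d : ℕ} (hd : 1 ≤ d) :
    IsZeroOnePolytope (orderPolytope d) := by
  obtain ⟨e, rfl⟩ : ∃ e, d = e + 1 := ⟨d - 1, by omega⟩
  rw [orderPolytope_succ]
  exact isZeroOnePolytope_fanPolytope _

theorem polytopeDim_orderPolytope {d : ℕ} (hd : 1 ≤ d) : polytopeDim (orderPolytope d) = d := by
  obtain ⟨e, rfl⟩ : ∃ e, d = e + 1 := ⟨d - 1, by omega⟩
  rw [orderPolytope_succ]
  exact polytopeDim_fanPolytope _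

theorem isEhrhartPolynomial_orderPolytope_one :
    IsEhrhartPolynomial (orderPolytope 1) (X + C 1) := by
  intro n hn
  rw [orderPolytope_succ, latticeCount_fanPolytope _ hn]
  simp

/-- Leaving the last coordinate free, apart from `0 ≤ x ≤ 1`, gives the product of an order
polytope with a unit interval. -/
theorem isEhrhartPolynomial_fanPolytope_erase_last {e : ℕ} (he : e ≠ 0) :
    IsEhrhartPolynomial (fanPolytope (Finset.univ.erase (Fin.last e)))
      ((X + C 1) * bernoulliEhrhart (e + 1)) := by
  intro n hn
  rw [latticeCount_fanPolytope _ hn, eval_mul, eval_bernoulliEhrhart_nat]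
  simp [zero_pow he, mul_comm]

/-- The index of the Bernoulli polynomial used in dimension `d`. -/
def bernoulliIndex (d : ℕ) : ℕ := if 4 ∣ d then d - 1 else d

theorem exists_zeroOnePolytope {d : ℕ} (hd : 2 ≤ d) :
    ∃ (P : Set (Fin d → ℝ)) (p : ℝ[X]), IsZeroOnePolytope P ∧ polytopeDim P = d ∧
      IsEhrhartPolynomial P p ∧ p.natDegree = d ∧
      (∀ x, (bernoulliEhrhart (bernoulliIndex d)).IsRoot x → p.IsRoot x) ∧
      (¬ 4 ∣ d → P = orderPolytope d) := by
  by_cases h4 : 4 ∣ d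
  · obtain ⟨e, rfl⟩ : ∃ e, d = e + 1 + 1 := ⟨d - 2, by omega⟩
    have hdeg := natDegree_bernoulliEhrhart (Nat.succ_ne_zero e)
    refine ⟨_, _, isZeroOnePolytope_fanPolytope _, polytopeDim_fanPolytope _,
      isEhrhartPolynomial_fanPolytope_erase_last (e := e) (by omega), ?_, fun x hx => ?_,
      fun h => absurd h4 h⟩
    · rw [natDegree_mul (X_add_C_ne_zero 1), natDegree_X_add_C, hdeg]
      · omega
      · intro h
        simp [h] at hdeg
    · rw [bernoulliIndex, if_pos h4, Nat.add_sub_cancel] at hx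
      rw [IsRoot.def, eval_mul, hx.eq_zero, mul_zero]
  · refine ⟨_, _, isZeroOnePolytope_orderPolytope (by omega), polytopeDim_orderPolytope (by omega),
      isEhrhartPolynomial_orderPolytope hd, natDegree_bernoulliEhrhart (by omega), fun x hx => ?_,
      fun _ => rfl⟩
    rwa [bernoulliIndex, if_neg h4] at hx

theorem two_le_bernoulliIndex {d : ℕ} (hd : 2 ≤ d) : 2 ≤ bernoulliIndex d := by
  rw [bernoulliIndex]
  split_ifs <;> omega

theorem tendsto_bernoulliIndex : Tendsto bernoulliIndex atTop atTop := by
  refine tendsto_atTop_mono (fun d => ?_) (tendsto_sub_atTop_nat 1)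
  rw [bernoulliIndex]
  split_ifs <;> omega

theorem eventually_exists_isRoot_bernoulliIndex {c : ℝ} (hc0 : 0 < c)
    (hc : c < 1 / (2 * Real.pi * Real.exp 1)) (hc1 : c ≤ 1) :
    ∀ᶠ d : ℕ in atTop, ∃ x : ℝ,
      (bernoulliEhrhart (bernoulliIndex d)).IsRoot x ∧ c * d - 5 ≤ x ∧ x ≤ c * d := by
  filter_upwards [tendsto_bernoulliIndex.eventually
    (eventually_exists_isRoot_bernoulliEhrhart hc0 hc), eventually_ge_atTop 1] with d hd hd1
  obtain ⟨x, hx, hx1, hx2⟩ := hd (by rw [bernoulliIndex]; split_ifs <;> omega)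
  have hle : (bernoulliIndex d : ℝ) ≤ d := by
    norm_cast; rw [bernoulliIndex]; split_ifs <;> omega
  have hge : (d : ℝ) ≤ bernoulliIndex d + 1 := by
    norm_cast; rw [bernoulliIndex]; split_ifs <;> omega
  refine ⟨x, hx, ?_, ?_⟩
  · nlinarith [mul_le_mul_of_nonneg_left hge hc0.le]
  · exact hx2.trans (mul_le_mul_of_nonneg_left hle hc0.le)

theorem one_div_two_pi_exp_bounds :
    0.0585 < 1 / (2 * Real.pi * Real.exp 1) ∧ 1 / (2 * Real.pi * Real.exp 1) < 0.0586 := by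
  have h1 := Real.pi_gt_d4
  have h2 := Real.pi_lt_d4
  have h3 := Real.exp_one_gt_d9
  have h4 := Real.exp_one_lt_d9
  constructor
  · rw [lt_div_iff₀ (by positivity)]
    nlinarith
  · rw [div_lt_iff₀ (by positivity)]
    nlinarith

/-- Taking the zero with `α d / d` closest to the limit avoids any upper bound on the zeros: one
nearby zero suffices. The zero `-1` guarantees a choice for every `d ≥ 2`. -/
theorem exists_root_sequence :
    ∃ α : ℕ → ℝ, (∀ d, 2 ≤ d → (bernoulliEhrhart (bernoulliIndex d)).IsRoot (α d)) ∧ α 1 = -1 ∧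
      Tendsto (fun d : ℕ => α d / (d : ℝ)) atTop (𝓝 (1 / (2 * Real.pi * Real.exp 1))) := by
  obtain ⟨hL1, hL2⟩ := one_div_two_pi_exp_bounds
  set L := 1 / (2 * Real.pi * Real.exp 1) with hL
  have hmin : ∀ d : ℕ, ∃ a : ℝ, (d = 1 → a = -1) ∧ (2 ≤ d →
      (bernoulliEhrhart (bernoulliIndex d)).IsRoot a ∧
      ∀ x, (bernoulliEhrhart (bernoulliIndex d)).IsRoot x → |a / d - L| ≤ |x / d - L|) := by
    intro d
    by_cases hd : 2 ≤ d
    · have hb := two_le_bernoulliIndex hd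
      have hne : bernoulliEhrhart (bernoulliIndex d) ≠ 0 := by
        intro h
        have := natDegree_bernoulliEhrhart (d := bernoulliIndex d) (by omega)
        rw [h, natDegree_zero] at this
        omega
      obtain ⟨a, ha, hmin⟩ := Set.exists_min_image
        {x : ℝ | (bernoulliEhrhart (bernoulliIndex d)).IsRoot x} (fun x => |x / d - L|)
        (finite_setOfPred_isRoot hne) ⟨-1, isRoot_bernoulliEhrhart_neg_one hb⟩
      exact ⟨a, fun h => by omega, fun _ => ⟨ha, hmin⟩⟩
    · exact ⟨-1, fun _ => rfl, fun h => absurd h hd⟩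
  choose α h1 h2 using hmin
  refine ⟨α, fun d hd => (h2 d hd).1, h1 1 rfl, ?_⟩
  rw [Metric.tendsto_atTop']
  intro ε hε
  -- Half of `ε` pays for `L - c`, the other half for the error `5 / d`.
  obtain ⟨c, hc1, hc2⟩ : ∃ c, max 0 (L - ε / 2) < c ∧ c < L :=
    exists_between (max_lt (by linarith) (by linarith))
  have hc0 := (le_max_left _ _).trans_lt hc1
  have hcε := (le_max_right _ _).trans_lt hc1
  have hev := eventually_exists_isRoot_bernoulliIndex hc0 hc2 (by linarith)
  have hlarge := (tendsto_natCast_atTop_atTop (R := ℝ)).eventually_gt_atTop (10 / ε)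
  obtain ⟨N, hN⟩ := eventually_atTop.1 (hev.and (hlarge.and (eventually_ge_atTop 2)))
  refine ⟨N, fun d hd => ?_⟩
  obtain ⟨⟨x, hx, hxl, hxu⟩, hdε, hd2⟩ := hN d hd.le
  have hd0 : (0 : ℝ) < d := by positivity
  rw [Real.dist_eq]
  refine ((h2 d hd2).2 x hx).trans_lt ?_
  rw [abs_lt]
  rw [div_lt_iff₀ hε] at hdε
  constructor
  · rw [lt_sub_iff_add_lt, lt_div_iff₀ hd0]
    nlinarith
  · rw [sub_lt_iff_lt_add, div_lt_iff₀ hd0]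
    nlinarith

theorem theorem1p3 :
    -- arbitrarily large real roots, in every sufficiently large degree
    (∀ t : ℝ, 0 < t → ∀ᶠ d : ℕ in atTop,
      ∃ (P : Set (Fin d → ℝ)) (p : ℝ[X]), IsLatticePolytope P ∧ polytopeDim P = d ∧
        IsEhrhartPolynomial P p ∧ p.natDegree = d ∧ ∃ x : ℝ, p.IsRoot x ∧ t < x) ∧
    -- 0/1-polytopes with a real zero of linear growth; order polytopes if 4 does not divide d
    (∃ α : ℕ → ℝ,
      (∀ d : ℕ, 1 ≤ d → ∃ (P : Set (Fin d → ℝ)) (p : ℝ[X]),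
        IsZeroOnePolytope P ∧ polytopeDim P = d ∧ IsEhrhartPolynomial P p ∧ p.IsRoot (α d) ∧
        (¬ 4 ∣ d → P = orderPolytope d)) ∧
      Tendsto (fun d : ℕ => α d / (d : ℝ)) atTop (𝓝 (1 / (2 * Real.pi * Real.exp 1)))) ∧
    -- the order polytopes and their Ehrhart polynomials
    (∀ d : ℕ, 1 ≤ d → IsZeroOnePolytope (orderPolytope d) ∧ polytopeDim (orderPolytope d) = d) ∧
    (∀ d : ℕ, 2 ≤ d → IsEhrhartPolynomial (orderPolytope d) (bernoulliEhrhart d)) ∧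
    -- the decimal value 0.0585…
    (0.0585 < 1 / (2 * Real.pi * Real.exp 1) ∧ 1 / (2 * Real.pi * Real.exp 1) < 0.0586) := by
  obtain ⟨hL1, hL2⟩ := one_div_two_pi_exp_bounds
  refine ⟨fun t _ => ?_, ?_, fun d hd =>
    ⟨isZeroOnePolytope_orderPolytope hd, polytopeDim_orderPolytope hd⟩,
    fun d hd => isEhrhartPolynomial_orderPolytope hd, hL1, hL2⟩
  · have hev := eventually_exists_isRoot_bernoulliIndex (c := 1 / 100) (by norm_num)
      (by norm_num at hL1 ⊢; linarith) (by norm_num)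
    have hlarge := (tendsto_natCast_atTop_atTop (R := ℝ)).eventually_gt_atTop (100 * (t + 5))
    filter_upwards [hev, hlarge, eventually_ge_atTop 2] with d ⟨x, hx, hxl, _⟩ hdt hd2
    obtain ⟨P, p, hP, hdim, hp, hdeg, hroot, -⟩ := exists_zeroOnePolytope hd2
    exact ⟨P, p, hP.isLatticePolytope, hdim, hp, hdeg, x, hroot x hx, by linarith⟩
  · obtain ⟨α, hα, hα1, hlim⟩ := exists_root_sequence
    refine ⟨α, fun d hd => ?_, hlim⟩
    rcases hd.eq_or_lt with rfl | hd2
    · exact ⟨_, _, isZeroOnePolytope_orderPolytope le_rfl, polytopeDim_orderPolytope le_rfl,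
        isEhrhartPolynomial_orderPolytope_one, by simp [hα1], fun _ => rfl⟩
    · obtain ⟨P, p, hP, hdim, hp, -, hroot, h4⟩ := exists_zeroOnePolytope hd2
      exact ⟨P, p, hP, hdim, hp, hroot _ (hα d hd2), h4⟩
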